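/- Let $G$ be a finite connected simple graph, with at least one edge, embedded in the plane so that every face (the outer face included) is a triangle, i.e. has a boundary walk of length three. The embedding is given combinatorially: by a cyclic order of the edges around each vertex whose facial walks, obtained by face tracing, satisfy $|V(G)|-|E(G)|+|F(G)|=2$. The expanded dual graph $G^*$ of $G$ has one vertex for each pair (edge $e$ of $G$, side of $e$). For each face of $G$, the three vertices given by the sides of edges lying along that face are pairwise adjacent (a "Fisher city", a triangle); and for each edge $e$ of $G$ the two vertices given by the two sides of $e$ are adjacent. The edges of the latter kind are called intercity edges, their set is $E^*_I$, and the intercity edge that joins the two sides of $e$ is said to cross $e$. Let $\mathrm{PM}(G^*)$ be the set of perfect matchings of $G^*$. For a spin configuration $X=(x_v)_{v\in V(G)}\in\{\pm1\}^{V(G)}$ let $I(X)\subseteq E^*_I$ be the set of intercity edges that cross an edge $\{v,w\}$ of $G$ with $x_v=x_w$. Then for every $X\in\{\pm1\}^{V(G)}$ there is exactly one perfect matching $M(X)\in\mathrm{PM}(G^*)$ with $M(X)\cap E^*_I=I(X)$, that is, $I(X)$ can be uniquely completed to a perfect matching of $G^*$ by edges of Fisher cities. Moreover, for every fixed vertex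 $v_1$ of $G$, the map $M$ restricts to a bijection from $\mathcal C_+=\{X\in\{\pm1\}^{V(G)} : x_{v_1}=+1\}$ onto $\mathrm{PM}(G^*)$. -/

import Mathlib

/-- A rotation system on a simple graph `G`, i.e. the combinatorial form of a cellular embedding of
`G` in an oriented surface: for every vertex `v`, a cyclic order on the darts (oriented edges)
leaving `v`. The orders are recorded by one permutation `rot` of the darts whose cycles are exactly
the sets of darts with a common source; `rot d` is the dart that follows `d` around its source. -/
structure RotationSystem {V : Type*} (G : SimpleGraph V) where
  rot : Equiv.Perm G.Dart
  rot_fst : ∀ d : G.Dart, (rot d).fst = d.fst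
  rot_sameCycle : ∀ d d' : G.Dart, d.fst = d'.fst → rot.SameCycle d d'

namespace RotationSystem

variable {V : Type*} {G : SimpleGraph V} (R : RotationSystem G)

/-- Face tracing: arrive at `d.snd` along `d`, turn to the next dart around `d.snd`. -/
def facePerm : Equiv.Perm G.Dart :=
  (SimpleGraph.Dart.symm_involutive (G := G)).toPerm.trans R.rot

/-- The faces of the embedding: cycles of face tracing. -/
def Face : Type _ :=
  Quotient (Equiv.Perm.SameCycle.setoid R.facePerm)

/-- The face on whose boundary walk the dart `d` lies. The darts `d` and `d.symm` represent the
two sides of an edge, and `R.face d`, `R.face d.symm` are the faces on these two sides. -/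
def face (d : G.Dart) : R.Face :=
  Quotient.mk (Equiv.Perm.SameCycle.setoid R.facePerm) d

/-- The embedded graph (with at least one edge) is connected, and the surface that carries it is
the sphere: `|V| - |E| + |F| = 2`. Equivalently, `R` is an embedding of a connected graph in the
plane, the outer face being one of the faces. -/
def IsPlane : Prop :=
  G.Connected ∧ Nat.card V + Nat.card R.Face = Nat.card G.edgeSet + 2

/-- Every face (the outer one included) is a triangle, i.e. its boundary walk has length three. -/
def IsTriangulated : Prop :=
  ∀ f : R.Face, {d : G.Dart | R.face d = f}.ncard = 3

/-- The expanded dual graph `G*`. Its vertices are the darts of `G` (pairs of an edge and a side of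
it), grouped by the face they lie on. Distinct vertices of one face are joined (Fisher city,
a triangle `K₃` when `G` is triangulated), and, for every edge of `G`, the vertices `d` and `d.symm`
that belong to its two sides are joined (intercity edge). -/
def expandedDual : SimpleGraph G.Dart where
  Adj d d' := d ≠ d' ∧ (R.face d = R.face d' ∨ d' = d.symm)
  symm := ⟨by
    rintro d d' ⟨hne, h | h⟩
    · exact ⟨hne.symm, Or.inl h.symm⟩
    · exact ⟨hne.symm, Or.inr (by rw [h, SimpleGraph.Dart.symm_symm])⟩⟩
  loopless := ⟨fun _ h => h.1 rfl⟩

/-- The set of intercity edges of `G*`. The edge `s(d, d.symm)` crosses the edge `d.edge` of `G`. -/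
def intercityEdges (_R : RotationSystem G) : Set (Sym2 G.Dart) :=
  {e | ∃ d : G.Dart, e = s(d, d.symm)}

/-- `I(X)`: the intercity edges that cross an edge `{v, w}` of `G` with `X v = X w`. -/
def saturated (_R : RotationSystem G) (X : V → ℤˣ) : Set (Sym2 G.Dart) :=
  {e | ∃ d : G.Dart, e = s(d, d.symm) ∧ X d.fst = X d.snd}

/-- `S` is a perfect matching of `G*` completing `I(X)` by Fisher city edges, i.e. by edges of `G*`
that are not intercity edges. -/
def Completes (X : V → ℤˣ) (S : R.expandedDual.Subgraph) : Prop :=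
  S.IsPerfectMatching ∧ S.edgeSet ∩ R.intercityEdges = R.saturated X

/-- `M(X)`: the perfect matching of `G*` completing `I(X)`. -/
noncomputable def matching (X : V → ℤˣ) : R.expandedDual.Subgraph :=
  Classical.epsilon (R.Completes X)

end RotationSystem

/-! In a perfect matching of `G*`, the darts not matched across their edge are matched in pairs
inside the Fisher cities, so they form a symmetric set of darts that meets every city evenly.
Conversely, an even subset of a triangle is empty or a pair, so such a set determines the matching:
perfect matchings of `G*` correspond to even symmetric sets of darts, and those completing `I(X)`
to the domain wall of `X`, the set of darts whose endpoints carry different spins.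

Over `ZMod 2`, the indicator of a domain wall is the coboundary of the spins, and an even symmetric
set is a cocycle. On the sphere every cocycle is a coboundary, over any field. Indeed the cocycles
are the kernel of a matrix with `|F| + |E|` rows and `2|E|` columns, and the kernel of its transpose
is at most one-dimensional because the dual graph is connected. So they have dimension at most
`2|E| - (|F| + |E|) + 1 = |V| - 1`, which is at most the rank of the coboundary.
-/

theorem forall_of_preconnected {V : Type*} {G : SimpleGraph V} (hG : G.Preconnected)
    {p : V → Prop} (hp : ∀ a b, G.Adj a b → p a → p b) {u : V} (hu : p u) (v : V) : p v := by
  induction (G.reachable_iff_reflTransGen u v).1 (hG u v) with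
  | refl => exact hu
  | tail _ hadj ih => exact hp _ _ hadj ih

theorem apply_eq_apply_of_sameCycle {α β : Type*} {σ : Equiv.Perm α} {g : α → β}
    (hg : ∀ a, g (σ a) = g a) {a b : α} (h : σ.SameCycle a b) : g a = g b := by
  have hpow (n : ℕ) (a : α) : g ((σ ^ n) a) = g a := by
    induction n with
    | zero => rfl
    | succ n ih => rw [pow_succ', Equiv.Perm.mul_apply, hg, ih]
  obtain ⟨n | n, rfl⟩ := h
  · exact (hpow n a).symm
  · simpa using hpow (n + 1) ((σ ^ (n + 1))⁻¹ a)

theorem finrank_ker_mulVecLin_add_card {m n K : Type*} [Fintype m] [Fintype n] [Field K]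
    (A : Matrix m n K) :
    Module.finrank K A.mulVecLin.ker + Fintype.card m =
      Module.finrank K A.transpose.mulVecLin.ker + Fintype.card n := by
  have hA := A.mulVecLin.finrank_range_add_finrank_ker
  have hAT := A.transpose.mulVecLin.finrank_range_add_finrank_ker
  have hrank : Module.finrank K A.transpose.mulVecLin.range =
      Module.finrank K A.mulVecLin.range := A.rank_transpose
  rw [Module.finrank_fintype_fun_eq_card] at hA hAT
  omega

theorem finrank_le_one_of_le_span_singleton {K M : Type*} [Field K] [AddCommGroup M] [Module K M]
    {W : Submodule K M} {v : M} (h : W ≤ Submodule.span K {v}) : Module.finrank K W ≤ 1 :=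
  (Submodule.finrank_mono h).trans (by simpa using finrank_span_le_card (R := K) {v})

namespace RotationSystem

variable {V : Type*} {G : SimpleGraph V} (R : RotationSystem G)

theorem facePerm_fst (d : G.Dart) : (R.facePerm d).fst = d.snd :=
  R.rot_fst d.symm

theorem facePerm_symm (d : G.Dart) : R.facePerm d.symm = R.rot d :=
  congrArg R.rot d.symm_symm

theorem face_facePerm (d : G.Dart) : R.face (R.facePerm d) = R.face d :=
  Quotient.sound (Equiv.Perm.sameCycle_apply_left.2 .rfl)

theorem face_surjective : Function.Surjective R.face := Quotient.mk_surjective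

theorem finite_face [Finite G.Dart] : Finite R.Face := Finite.of_surjective _ R.face_surjective

/-- The Fisher city of a face, as a set of vertices of the expanded dual graph. -/
def city (f : R.Face) : Set G.Dart := {d | R.face d = f}

/-- The edge underlying a dart, as an element of the edge set, so that it can index the rows of
`cellMatrix`. -/
def dartEdge (d : G.Dart) : G.edgeSet := ⟨d.edge, d.edge_mem⟩

theorem dartEdge_eq_iff {d d' : G.Dart} : dartEdge d = dartEdge d' ↔ d = d' ∨ d = d'.symm := by
  rw [dartEdge, dartEdge, Subtype.mk.injEq, SimpleGraph.dart_edge_eq_iff]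

theorem dartEdge_surjective : Function.Surjective (dartEdge (G := G)) := by
  rintro ⟨e, he⟩
  induction e using Sym2.ind with
  | _ a b => exact ⟨⟨(a, b), he⟩, rfl⟩

theorem apply_face_eq_of_forall_symm (hG : G.Preconnected) {α : Type*} {g : R.Face → α}
    (hg : ∀ d : G.Dart, g (R.face d.symm) = g (R.face d)) (f f' : R.Face) : g f = g f' := by
  have hrot (d : G.Dart) : g (R.face (R.rot d)) = g (R.face d) := by
    rw [← facePerm_symm, face_facePerm, hg]
  have hfst {d d' : G.Dart} (h : d.fst = d'.fst) : g (R.face d) = g (R.face d') :=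
    apply_eq_apply_of_sameCycle (g := fun d => g (R.face d)) hrot (R.rot_sameCycle d d' h)
  obtain ⟨d, rfl⟩ := R.face_surjective f
  obtain ⟨d', rfl⟩ := R.face_surjective f'
  refine forall_of_preconnected hG (p := fun v => ∀ e : G.Dart, e.fst = v →
    g (R.face d) = g (R.face e)) (fun a b hab ha e he => ?_) (fun e he => hfst he.symm) _ d' rfl
  let ab : G.Dart := ⟨(a, b), hab⟩
  calc g (R.face d) = g (R.face ab) := ha ab rfl
    _ = g (R.face ab.symm) := (hg ab).symm
    _ = g (R.face e) := hfst he.symm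

/-- A `1`-cocycle of the embedding: an antisymmetric function on the darts whose sum around every
face vanishes. Pitfall: the `finsum` over an infinite city is `0` if the support is infinite. -/
structure IsCocycle {A : Type*} [AddCommGroup A] (w : G.Dart → A) : Prop where
  symm (d : G.Dart) : w d.symm = -w d
  sum_city (f : R.Face) : ∑ᶠ d ∈ R.city f, w d = 0

section Coboundary

variable (G) (K : Type*) [Ring K]

/-- The coboundary of a function on the vertices: its increment along each dart. -/
def coboundary : (V → K) →ₗ[K] (G.Dart → K) :=
  LinearMap.funLeft K K (fun d : G.Dart => d.snd) - LinearMap.funLeft K K (fun d : G.Dart => d.fst)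

variable {G K}

theorem coboundary_apply (x : V → K) (d : G.Dart) : coboundary G K x d = x d.snd - x d.fst := rfl

theorem isCocycle_coboundary (hfin : ∀ f, (R.city f).Finite) (x : V → K) :
    R.IsCocycle (coboundary G K x) where
  symm d := (neg_sub _ _).symm
  sum_city f := by
    have hbij : Set.BijOn R.facePerm (R.city f) (R.city f) :=
      R.facePerm.bijOn fun d => by simp only [city, Set.mem_ofPred_eq, face_facePerm]
    simp only [coboundary_apply]
    rw [finsum_mem_sub_distrib _ _ (hfin f), sub_eq_zero]
    exact finsum_mem_eq_of_bijOn _ hbij fun d _ => by rw [facePerm_fst]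

end Coboundary

section Plane

variable (K : Type*) [Field K]

theorem finrank_ker_coboundary_le_one (hG : G.Connected) :
    Module.finrank K (coboundary G K).ker ≤ 1 := by
  obtain ⟨v⟩ := hG.nonempty
  refine finrank_le_one_of_le_span_singleton (v := 1) fun x hx => ?_
  rw [Submodule.mem_span_singleton]
  have hadj (a b : V) (hab : G.Adj a b) : x b = x a :=
    sub_eq_zero.1 (congrFun hx ⟨(a, b), hab⟩)
  have hconst (u : V) : x u = x v :=
    forall_of_preconnected hG.preconnected (p := fun u => x u = x v)
      (fun a b hab ha => (hadj a b hab).trans ha) rfl u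
  exact ⟨x v, funext fun u => by simp [hconst u]⟩

/-- The incidence matrix of faces and edges with darts, whose kernel consists of the functions that
vanish in sum on every face and every pair `d`, `d.symm`. With a row for each edge, antisymmetry is
a linear condition and no orientation of the edges has to be chosen. -/
noncomputable def cellMatrix : Matrix (R.Face ⊕ G.edgeSet) G.Dart K :=
  Matrix.of <| Sum.elim (fun f => (R.city f).indicator 1)
    fun e => {d | dartEdge d = e}.indicator 1

variable {K}

theorem cellMatrix_mulVec_inl [Fintype G.Dart] (w : G.Dart → K) (f : R.Face) :
    (R.cellMatrix K).mulVec w (.inl f) = ∑ᶠ d ∈ R.city f, w d := by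
  classical
  rw [finsum_mem_def, finsum_eq_sum_of_fintype]
  simp [Matrix.mulVec, dotProduct, cellMatrix, Set.indicator_apply]

theorem cellMatrix_mulVec_inr [Fintype G.Dart] (w : G.Dart → K) (d : G.Dart) :
    (R.cellMatrix K).mulVec w (.inr (dartEdge d)) = w d + w d.symm := by
  classical
  rw [← Finset.sum_pair d.symm_ne.symm, ← Finset.univ_inter {d, d.symm}, ← Finset.sum_ite_mem]
  simp [Matrix.mulVec, dotProduct, cellMatrix, Set.indicator_apply, dartEdge_eq_iff]

theorem cellMatrix_mulVec_eq_zero_iff [Fintype G.Dart] {w : G.Dart → K} :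
    (R.cellMatrix K).mulVec w = 0 ↔ R.IsCocycle w := by
  simp only [funext_iff, Sum.forall, dartEdge_surjective.forall, cellMatrix_mulVec_inl,
    cellMatrix_mulVec_inr, Pi.zero_apply]
  exact ⟨fun h => ⟨fun d => eq_neg_of_add_eq_zero_right (h.2 d), h.1⟩,
    fun h => ⟨h.sum_city, fun d => by rw [h.symm, add_neg_cancel]⟩⟩

theorem cellMatrix_transpose_mulVec [Fintype R.Face] [Fintype G.edgeSet]
    (y : R.Face ⊕ G.edgeSet → K) (d : G.Dart) :
    (R.cellMatrix K).transpose.mulVec y d = y (.inl (R.face d)) + y (.inr (dartEdge d)) := by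
  classical
  simp [Matrix.mulVec, dotProduct, cellMatrix, Set.indicator_apply, city]

theorem finrank_ker_cellMatrix_transpose_le_one [Fintype R.Face] [Fintype G.edgeSet]
    (hG : G.Preconnected) :
    Module.finrank K (R.cellMatrix K).transpose.mulVecLin.ker ≤ 1 := by
  refine finrank_le_one_of_le_span_singleton (v := Sum.elim 1 (-1)) fun y hy => ?_
  rw [Submodule.mem_span_singleton]
  have hedge (d : G.Dart) : y (.inr (dartEdge d)) = -y (.inl (R.face d)) := by
    rw [eq_neg_iff_add_eq_zero, add_comm, ← cellMatrix_transpose_mulVec]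
    exact congrFun hy d
  have hconst := R.apply_face_eq_of_forall_symm hG (g := fun f => y (.inl f)) fun d => by
    have := hedge d.symm
    rw [dartEdge_eq_iff.2 (.inr rfl), hedge d, neg_inj] at this
    exact this.symm
  obtain ⟨c, hc⟩ : ∃ c, ∀ f, y (.inl f) = c := by
    rcases isEmpty_or_nonempty R.Face with _ | ⟨⟨f₀⟩⟩
    · exact ⟨0, isEmptyElim⟩
    · exact ⟨y (.inl f₀), fun f => hconst f f₀⟩
  refine ⟨c, funext <| Sum.forall.2 ⟨fun f => ?_, dartEdge_surjective.forall.2 fun d => ?_⟩⟩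
  · simp [hc]
  · simp [hedge, hc]

variable {R}

theorem IsPlane.exists_coboundary_eq [Finite V] (hR : R.IsPlane) {w : G.Dart → K}
    (hw : R.IsCocycle w) : ∃ x, coboundary G K x = w := by
  classical
  have := Fintype.ofFinite V
  have := R.finite_face
  have := Fintype.ofFinite R.Face
  obtain ⟨hG, hEuler⟩ := hR
  have hcocycle (w : G.Dart → K) : w ∈ (R.cellMatrix K).mulVecLin.ker ↔ R.IsCocycle w :=
    R.cellMatrix_mulVec_eq_zero_iff
  have hle : (coboundary G K).range ≤ (R.cellMatrix K).mulVecLin.ker := by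
    rintro _ ⟨x, rfl⟩
    exact (hcocycle _).2 (R.isCocycle_coboundary (fun _ => Set.toFinite _) x)
  have hfinrank : Module.finrank K (R.cellMatrix K).mulVecLin.ker ≤
      Module.finrank K (coboundary G K).range := by
    have hcoboundary := (coboundary G K).finrank_range_add_finrank_ker
    have hcell := finrank_ker_mulVecLin_add_card (R.cellMatrix K)
    have hdart := G.dart_card_eq_twice_card_edges
    have hker := finrank_ker_coboundary_le_one K hG
    have hcoker := R.finrank_ker_cellMatrix_transpose_le_one (K := K) hG.preconnected
    rw [Module.finrank_fintype_fun_eq_card] at hcoboundary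
    rw [Fintype.card_sum] at hcell
    rw [SimpleGraph.edgeFinset_card] at hdart
    simp only [Nat.card_eq_fintype_card] at hEuler
    omega
  have hmem : w ∈ (coboundary G K).range :=
    Submodule.eq_of_le_of_finrank_le hle hfinrank ▸ (hcocycle w).2 hw
  exact hmem

end Plane

/-- An even set of darts: a set that contains `d.symm` along with `d` and an even number of darts of
every face (see `isEven_iff`), encoded as a cocycle modulo `2`. -/
def IsEven (U : Set G.Dart) : Prop :=
  R.IsCocycle (U.indicator (1 : G.Dart → ZMod 2))

variable {R}

theorem isEven_iff (hfin : ∀ f, (R.city f).Finite) {U : Set G.Dart} :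
    R.IsEven U ↔ (∀ d : G.Dart, d.symm ∈ U ↔ d ∈ U) ∧ ∀ f, Even (R.city f ∩ U).ncard := by
  have hsymm (d : G.Dart) :
      U.indicator (1 : G.Dart → ZMod 2) d.symm = -U.indicator 1 d ↔ (d.symm ∈ U ↔ d ∈ U) := by
    by_cases hd : d ∈ U <;> by_cases hd' : d.symm ∈ U <;> simp [hd, hd']
  have hsum (f : R.Face) :
      ∑ᶠ d ∈ R.city f, U.indicator (1 : G.Dart → ZMod 2) d = 0 ↔ Even (R.city f ∩ U).ncard := by
    have hcity : (R.city f ∩ U).Finite := (hfin f).inter_of_left U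
    rw [← ZMod.natCast_eq_zero_iff_even, finsum_mem_def, Set.indicator_indicator, ← finsum_mem_def,
      finsum_mem_eq_finite_toFinset_sum _ hcity, Set.ncard_eq_toFinset_card _ hcity]
    simp
  exact ⟨fun h => ⟨fun d => (hsymm d).1 (h.symm d), fun f => (hsum f).1 (h.sum_city f)⟩,
    fun h => ⟨fun d => (hsymm d).2 (h.1 d), fun f => (hsum f).2 (h.2 f)⟩⟩

/-- The domain wall of a spin configuration: the darts that join vertices of different spin. -/
def domainWall (X : V → ℤˣ) : Set G.Dart := {d | X d.fst ≠ X d.snd}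

theorem indicator_domainWall_neg_one_uzpow (x : V → ZMod 2) :
    (domainWall fun v => (-1) ^ x v).indicator 1 = coboundary G (ZMod 2) x := by
  have hsub : ∀ a b : ZMod 2, (if (-1 : ℤˣ) ^ a ≠ (-1) ^ b then 1 else 0) = b - a := by decide
  ext d
  rw [coboundary_apply, ← hsub]
  by_cases hd : d ∈ domainWall fun v => (-1) ^ x v
  · exact (Set.indicator_of_mem hd 1).trans (if_pos hd).symm
  · exact (Set.indicator_of_notMem hd 1).trans (if_neg hd).symm

theorem isEven_domainWall (hfin : ∀ f, (R.city f).Finite) (X : V → ℤˣ) :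
    R.IsEven (domainWall X) := by
  have hpow : ∀ u : ℤˣ, ∃ a : ZMod 2, (-1) ^ a = u := by decide
  choose x hx using fun v => hpow (X v)
  obtain rfl : (fun v => (-1) ^ x v) = X := funext hx
  rw [IsEven, indicator_domainWall_neg_one_uzpow]
  exact R.isCocycle_coboundary hfin x

theorem IsPlane.exists_domainWall_eq [Finite V] (hR : R.IsPlane) {U : Set G.Dart}
    (hU : R.IsEven U) (v : V) : ∃ X : V → ℤˣ, X v = 1 ∧ domainWall X = U := by
  obtain ⟨x, hx⟩ := hR.exists_coboundary_eq hU
  refine ⟨fun u => (-1) ^ (x u - x v), by simp, ?_⟩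
  refine Set.indicator_one_inj (ZMod 2) ?_
  rw [indicator_domainWall_neg_one_uzpow fun u => x u - x v, ← hx]
  ext d
  simp [coboundary_apply]

theorem domainWall_injOn (hG : G.Preconnected) (v : V) :
    Set.InjOn (domainWall (G := G)) {X | X v = 1} := by
  intro X hX Y hY hXY
  have hflip : ∀ a b c d : ℤˣ, (a ≠ b ↔ c ≠ d) → a = c → b = d := by decide
  refine funext <| forall_of_preconnected hG (fun a b hab => ?_) (hX.trans (Eq.symm hY) : X v = Y v)
  exact hflip _ _ _ _ (Set.ext_iff.1 hXY ⟨(a, b), hab⟩)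

/-- The vertices of the expanded dual graph that a matching `S` leaves to be matched inside their
Fisher cities: those not covered by an intercity edge of `S`. -/
def cityDarts (S : R.expandedDual.Subgraph) : Set G.Dart := {d | ¬ S.Adj d d.symm}

theorem adj_symm_comm (S : R.expandedDual.Subgraph) (d : G.Dart) :
    S.Adj d.symm d.symm.symm ↔ S.Adj d d.symm := by
  rw [d.symm_symm, S.adj_comm]

theorem face_eq_and_mem_cityDarts {S : R.expandedDual.Subgraph} (hS : S.IsMatching)
    {d d' : G.Dart} (hd : d ∈ cityDarts S) (hadj : S.Adj d d') :
    R.face d' = R.face d ∧ d' ∈ cityDarts S := by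
  have hne : d' ≠ d.symm := by
    rintro rfl
    exact hd hadj
  refine ⟨((S.adj_sub hadj).2.resolve_right hne).symm, fun hd' => hne ?_⟩
  rw [hS.eq_of_adj_left hadj.symm hd', d'.symm_symm]

theorem isEven_cityDarts (hfin : ∀ f, (R.city f).Finite) {S : R.expandedDual.Subgraph}
    (hS : S.IsPerfectMatching) : R.IsEven (cityDarts S) := by
  refine (isEven_iff hfin).2 ⟨fun d => not_congr (adj_symm_comm S d), fun f => ?_⟩
  have hcity : (R.city f ∩ cityDarts S).Finite := (hfin f).inter_of_left _
  have hmatching : (S.induce (R.city f ∩ cityDarts S)).IsMatching := by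
    rintro d ⟨rfl, hd⟩
    obtain ⟨d', hadj, -⟩ := SimpleGraph.Subgraph.isPerfectMatching_iff.1 hS d
    exact ⟨d', ⟨⟨rfl, hd⟩, face_eq_and_mem_cityDarts hS.1 hd hadj, hadj⟩,
      fun e he => hS.1.eq_of_adj_left he.2.2 hadj⟩
  have : Fintype (S.induce (R.city f ∩ cityDarts S)).verts := hcity.fintype
  have heven := hmatching.even_card
  rwa [← Set.ncard_eq_toFinset_card'] at heven

/-- The candidate for the perfect matching with `cityDarts` equal to `U`, made up of the intercity
edges outside `U` and all Fisher city edges inside `U`. -/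
def cityMatching (R : RotationSystem G) (U : Set G.Dart) (hU : ∀ d : G.Dart, d.symm ∈ U ↔ d ∈ U) :
    R.expandedDual.Subgraph where
  verts := Set.univ
  Adj d d' := (d ∉ U ∧ d' = d.symm) ∨ (d ∈ U ∧ d' ∈ U ∧ d ≠ d' ∧ R.face d = R.face d')
  adj_sub := by
    rintro d _ (⟨-, rfl⟩ | ⟨-, -, hne, hface⟩)
    · exact ⟨d.symm_ne.symm, .inr rfl⟩
    · exact ⟨hne, .inl hface⟩
  edge_vert _ := Set.mem_univ _
  symm := ⟨by
    rintro d _ (⟨hd, rfl⟩ | ⟨hd, hd', hne, hface⟩)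
    · exact .inl ⟨(hU d).not.2 hd, d.symm_symm.symm⟩
    · exact .inr ⟨hd', hd, hne.symm, hface.symm⟩⟩

theorem IsTriangulated.finite_city (hR : R.IsTriangulated) (f : R.Face) : (R.city f).Finite :=
  Set.finite_of_ncard_ne_zero ((hR f).trans_ne three_ne_zero)

theorem IsTriangulated.existsUnique_city_partner (hR : R.IsTriangulated) {U : Set G.Dart}
    (hU : R.IsEven U) {d : G.Dart} (hd : d ∈ U) :
    ∃! d', d' ∈ U ∧ d ≠ d' ∧ R.face d = R.face d' := by
  have hmem : d ∈ R.city (R.face d) ∩ U := ⟨rfl, hd⟩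
  have hfin := hR.finite_city (R.face d)
  have heven : Even (R.city (R.face d) ∩ U).ncard := ((isEven_iff hR.finite_city).1 hU).2 _
  have hle : (R.city (R.face d) ∩ U).ncard ≤ 3 :=
    (Set.ncard_le_ncard Set.inter_subset_left hfin).trans_eq (hR _)
  have hpos : 0 < (R.city (R.face d) ∩ U).ncard :=
    (Set.ncard_pos (hfin.inter_of_left U)).2 ⟨d, hmem⟩
  have hone : ((R.city (R.face d) ∩ U) \ {d}).ncard = 1 := by
    rw [Set.ncard_sdiff_singleton_of_mem hmem]
    grind
  obtain ⟨d', hd'⟩ := Set.ncard_eq_one.1 hone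
  have hiff (e : G.Dart) : e ∈ U ∧ d ≠ e ∧ R.face d = R.face e ↔ e = d' := by
    rw [← Set.mem_singleton_iff (b := d'), ← hd']
    simp only [city, Set.mem_sdiff, Set.mem_inter_iff, Set.mem_ofPred_eq, Set.mem_singleton_iff]
    tauto
  exact ⟨d', (hiff d').2 rfl, fun e => (hiff e).1⟩

theorem IsTriangulated.face_symm_ne (hR : R.IsTriangulated) (d : G.Dart) :
    R.face d.symm ≠ R.face d := by
  -- If one face lay on both sides of `d`, consider the domain wall around an end of its third
  -- dart `e`: it contains `e`, and both or none of `d` and `d.symm`, an odd number in total.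
  classical
  intro hface
  have hpair : {d, d.symm} ⊆ R.city (R.face d) := by
    rintro _ (rfl | rfl)
    exacts [rfl, hface]
  obtain ⟨e, he⟩ : ∃ e, R.city (R.face d) \ {d, d.symm} = {e} := by
    rw [← Set.ncard_eq_one, Set.ncard_sdiff hpair, Set.ncard_pair d.symm_ne.symm]
    exact congrArg (· - 2) (hR _)
  obtain ⟨hecity, hepair⟩ : e ∈ R.city (R.face d) \ {d, d.symm} := he ▸ rfl
  let X : V → ℤˣ := fun v => if v = e.fst then -1 else 1
  have heX : e ∈ domainWall X := by simp [domainWall, X, e.snd_ne_fst]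
  obtain ⟨d', ⟨hX, hne, hcity⟩, huniq⟩ :=
    hR.existsUnique_city_partner (isEven_domainWall hR.finite_city X) heX
  have hd' : d' ∈ ({d, d.symm} : Set G.Dart) := by
    by_contra hpair'
    exact hne (he.subset ⟨hcity.symm.trans hecity, hpair'⟩).symm
  have hsymm : d'.symm ∈ ({d, d.symm} : Set G.Dart) := by
    rcases hd' with rfl | rfl
    exacts [.inr rfl, .inl d.symm_symm]
  refine d'.symm_ne (huniq d'.symm ⟨hX.symm, ?_, hecity.trans (hpair hsymm).symm⟩)
  rintro rfl
  exact hepair hsymm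

theorem IsTriangulated.isPerfectMatching_cityMatching (hR : R.IsTriangulated) {U : Set G.Dart}
    (hU : R.IsEven U) (hsymm : ∀ d : G.Dart, d.symm ∈ U ↔ d ∈ U) :
    (R.cityMatching U hsymm).IsPerfectMatching := by
  refine SimpleGraph.Subgraph.isPerfectMatching_iff.2 fun d => ?_
  by_cases hd : d ∈ U
  · simpa [cityMatching, hd] using hR.existsUnique_city_partner hU hd
  · simp [cityMatching, hd]

theorem IsTriangulated.cityDarts_cityMatching (hR : R.IsTriangulated) {U : Set G.Dart}
    (hsymm : ∀ d : G.Dart, d.symm ∈ U ↔ d ∈ U) : cityDarts (R.cityMatching U hsymm) = U := by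
  ext d
  simp [cityDarts, cityMatching, (hR.face_symm_ne d).symm]

theorem IsTriangulated.cityMatching_cityDarts (hR : R.IsTriangulated)
    {S : R.expandedDual.Subgraph} (hS : S.IsPerfectMatching)
    (hsymm : ∀ d : G.Dart, d.symm ∈ cityDarts S ↔ d ∈ cityDarts S) :
    R.cityMatching (cityDarts S) hsymm = S := by
  refine SimpleGraph.Subgraph.ext hS.2.verts_eq_univ.symm (funext₂ fun d d' => propext ?_)
  by_cases hd : d ∈ cityDarts S
  · obtain ⟨e, he, -⟩ := SimpleGraph.Subgraph.isPerfectMatching_iff.1 hS d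
    obtain ⟨hface, hmem⟩ := face_eq_and_mem_cityDarts hS.1 hd he
    have hpartner := hR.existsUnique_city_partner (isEven_cityDarts hR.finite_city hS) hd
    have he_iff : d' ∈ cityDarts S ∧ d ≠ d' ∧ R.face d = R.face d' ↔ d' = e :=
      ⟨fun h => hpartner.unique h ⟨hmem, he.ne, hface.symm⟩,
        fun h => h ▸ ⟨hmem, he.ne, hface.symm⟩⟩
    have hS_iff : S.Adj d d' ↔ d' = e := ⟨fun h => hS.1.eq_of_adj_left h he, fun h => h ▸ he⟩
    simp only [cityMatching, hd, not_true, false_and, true_and, false_or, he_iff, hS_iff]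
  · have hadj : S.Adj d d.symm := not_not.1 hd
    have hS_iff : S.Adj d d' ↔ d' = d.symm :=
      ⟨fun h => hS.1.eq_of_adj_left h hadj, fun h => h ▸ hadj⟩
    simp only [cityMatching, hd, not_false_eq_true, true_and, false_and, or_false, hS_iff]

theorem IsTriangulated.existsUnique_cityDarts_eq (hR : R.IsTriangulated) {U : Set G.Dart}
    (hU : R.IsEven U) :
    ∃! S : R.expandedDual.Subgraph, S.IsPerfectMatching ∧ cityDarts S = U := by
  have hsymm := ((isEven_iff hR.finite_city).1 hU).1
  refine ⟨R.cityMatching U hsymm,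
    ⟨hR.isPerfectMatching_cityMatching hU hsymm, hR.cityDarts_cityMatching hsymm⟩, ?_⟩
  rintro S ⟨hS, rfl⟩
  exact (hR.cityMatching_cityDarts hS hsymm).symm

theorem completes_iff {X : V → ℤˣ} {S : R.expandedDual.Subgraph} :
    R.Completes X S ↔ S.IsPerfectMatching ∧ cityDarts S = domainWall X := by
  have hsaturated (d : G.Dart) : s(d, d.symm) ∈ R.saturated X ↔ d ∉ domainWall X := by
    constructor
    · rintro ⟨d', hdd', hX⟩
      rcases Sym2.eq_iff.1 hdd' with ⟨rfl, -⟩ | ⟨rfl, -⟩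
      exacts [not_not.2 hX, not_not.2 hX.symm]
    · exact fun hd => ⟨d, rfl, not_not.1 hd⟩
  have hsub : R.saturated X ⊆ R.intercityEdges := fun _ ⟨d, he, _⟩ => ⟨d, he⟩
  refine and_congr_right fun _ => ⟨fun h => ?_, fun h => ?_⟩
  · ext d
    rw [← not_iff_not, ← hsaturated, ← h]
    exact ⟨fun hd => ⟨not_not.1 hd, d, rfl⟩, fun hd => not_not.2 hd.1⟩
  · refine Set.ext fun e => ⟨?_, fun he => ⟨?_, hsub he⟩⟩
    · rintro ⟨he, d, rfl⟩
      exact (hsaturated d).2 (h ▸ not_not.2 he)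
    · obtain ⟨d, rfl⟩ := hsub he
      exact not_not.1 (h ▸ (hsaturated d).1 he : d ∉ cityDarts S)

theorem IsTriangulated.existsUnique_completes (hR : R.IsTriangulated) (X : V → ℤˣ) :
    ∃! S, R.Completes X S := by
  simpa only [completes_iff] using
    hR.existsUnique_cityDarts_eq (isEven_domainWall hR.finite_city X)

end RotationSystem

theorem mainTheorem9 {V : Type*} [Finite V] (G : SimpleGraph V) (R : RotationSystem G)
    (hplane : R.IsPlane) (htri : R.IsTriangulated) (v₁ : V) :
    (∀ X : V → ℤˣ, ∃! S : R.expandedDual.Subgraph, R.Completes X S) ∧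
    (∀ X : V → ℤˣ, R.Completes X (R.matching X)) ∧
    Set.BijOn R.matching {X : V → ℤˣ | X v₁ = 1}
      {S : R.expandedDual.Subgraph | S.IsPerfectMatching} := by
  have hunique := htri.existsUnique_completes
  have hmatching (X : V → ℤˣ) : R.Completes X (R.matching X) :=
    Classical.epsilon_spec (hunique X).exists
  have hwall (X : V → ℤˣ) : RotationSystem.cityDarts (R.matching X) =
      RotationSystem.domainWall X := (RotationSystem.completes_iff.1 (hmatching X)).2
  refine ⟨hunique, hmatching, fun X _ => (hmatching X).1, fun X hX Y hY hXY => ?_, fun S hS => ?_⟩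
  · refine RotationSystem.domainWall_injOn hplane.1.preconnected v₁ hX hY ?_
    rw [← hwall X, hXY, hwall Y]
  · obtain ⟨X, hX, hXS⟩ :=
      hplane.exists_domainWall_eq (RotationSystem.isEven_cityDarts htri.finite_city hS) v₁
    exact ⟨X, hX, (hunique X).unique (hmatching X) (RotationSystem.completes_iff.2 ⟨hS, hXS.symm⟩)⟩
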